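/- Let $d$ be a positive square-free integer with $d\equiv 3 \pmod 4$, and let $\chi_{-d}$ be the quadratic Dirichlet character (modulo $d$) associated to $\mathbb{Q}(\sqrt{-d})$; thus for primes $p$ one has $\chi_{-d}(p)=\left(\frac{-d}{p}\right)$ if $p$ is odd, and $\chi_{-d}(2)=(-1)^{(d^2-1)/8}$. For a positive integer $n$ let $$F(n)=n\prod_{p\mid n}\left(1+\chi_{-d}(p)\,p^{-1}\right),$$ the product being over the primes $p$ dividing $n$. Let $a$ be a positive integer all of whose prime factors divide $d$, and let $r$ be any integer. Then the infinite product over all primes $$C=\prod_{p}\left(1-p^{-1}+(p+\chi_{-d}(p))^{-1}\right)$$ converges, for every real $X$ there are only finitely many positive integers $n$ with $n\equiv r \pmod a$ and $F(n)<X$, and, as $X\to\infty$, $$\#\{n\ge 1 : n\equiv r \ (\mathrm{mod}\ a),\ F(n)<X\}=\frac{C}{a}\,X+o(X).$$ -/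

import Mathlib

open Filter Asymptotics
open scoped NumberTheorySymbols

/-- The quadratic Dirichlet character `χ_{-d}` modulo `d`, `n ↦ (n / d)` (Jacobi symbol).
For a positive squarefree `d ≡ 3 (mod 4)` the field `ℚ(√-d)` has discriminant `-d`, and this is the
quadratic Dirichlet character associated to that field: see `quadCharNeg_odd_prime` (value
`(-d / p)` at an odd prime `p`) and `quadCharNeg_two` (value `(-1) ^ ((d ^ 2 - 1) / 8)` at `2`). -/
def quadCharNeg (d : ℕ) [NeZero d] : DirichletCharacter ℤ d where
  toFun x := J((x.val : ℤ) | d)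
  map_one' := by
    rw [ZMod.val_one_eq_one_mod, Int.natCast_mod, ← jacobiSym.mod_left, Nat.cast_one,
      jacobiSym.one_left]
  map_mul' x y := by
    rw [ZMod.val_mul, Int.natCast_mod, ← jacobiSym.mod_left, Nat.cast_mul, jacobiSym.mul_left]
  map_nonunit' x hx := by
    rw [jacobiSym.eq_zero_iff_not_coprime, Int.gcd_natCast_natCast]
    intro h
    apply hx
    rw [← ZMod.natCast_zmod_val x]
    exact (ZMod.isUnit_iff_coprime _ _).2 h

theorem quadCharNeg_natCast (d : ℕ) [NeZero d] (n : ℕ) :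
    quadCharNeg d (n : ZMod d) = J((n : ℤ) | d) := by
  change J((((n : ZMod d).val : ℕ) : ℤ) | d) = _
  rw [ZMod.val_natCast, Int.natCast_mod, ← jacobiSym.mod_left]

theorem quadCharNeg_odd_prime (d : ℕ) [NeZero d] (hd : d % 4 = 3) (p : ℕ) [Fact p.Prime]
    (hp : p ≠ 2) : quadCharNeg d (p : ZMod d) = legendreSym p (-(d : ℤ)) := by
  have hpo : Odd p := (Fact.out : p.Prime).odd_of_ne_two hp
  have hdo : Odd d := Nat.odd_iff.2 (by omega)
  rw [quadCharNeg_natCast, jacobiSym.legendreSym.to_jacobiSym, jacobiSym.neg _ hpo]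
  have hmod : p % 4 = 1 ∨ p % 4 = 3 := by
    have := Nat.odd_iff.1 hpo
    omega
  rcases hmod with h | h
  · rw [ZMod.χ₄_nat_one_mod_four h, one_mul]
    exact jacobiSym.quadratic_reciprocity_one_mod_four h hdo
  · rw [ZMod.χ₄_nat_three_mod_four h, neg_one_mul]
    exact jacobiSym.quadratic_reciprocity_three_mod_four h hd

theorem quadCharNeg_two (d : ℕ) [NeZero d] (hd : d % 4 = 3) :
    quadCharNeg d (2 : ZMod d) = (-1) ^ ((d ^ 2 - 1) / 8) := by
  have hdo : Odd d := Nat.odd_iff.2 (by omega)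
  have h := quadCharNeg_natCast d 2
  rw [Nat.cast_ofNat, Nat.cast_ofNat, jacobiSym.at_two hdo] at h
  rw [h, ZMod.χ₈_nat_eq_if_mod_eight, if_neg (by omega)]
  obtain ⟨k, hk⟩ : ∃ k, d = 8 * k + 3 ∨ d = 8 * k + 7 := ⟨d / 8, by omega⟩
  rcases hk with hk | hk
  · have h2 : (d ^ 2 - 1) / 8 = 2 * (4 * k ^ 2 + 3 * k) + 1 := by
      have : d ^ 2 = 8 * (2 * (4 * k ^ 2 + 3 * k) + 1) + 1 := by subst hk; ring
      omega
    rw [if_neg (by omega), h2, pow_succ, pow_mul]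
    norm_num
  · have h2 : (d ^ 2 - 1) / 8 = 2 * (4 * k ^ 2 + 7 * k + 3) := by
      have : d ^ 2 = 8 * (2 * (4 * k ^ 2 + 7 * k + 3)) + 1 := by subst hk; ring
      omega
    rw [if_pos (by omega), h2, pow_mul]
    norm_num

/-- `F(n) = n ∏_{p ∣ n} (1 + χ_{-d}(p) p⁻¹)`, the product being over the primes dividing `n`. -/
noncomputable def twistedPsi (d : ℕ) [NeZero d] (n : ℕ) : ℝ :=
  (n : ℝ) * ∏ p ∈ n.primeFactors, (1 + ((quadCharNeg d (p : ZMod d) : ℤ) : ℝ) * (p : ℝ)⁻¹)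

/-- The factor `1 - p⁻¹ + (p + χ_{-d}(p))⁻¹` of the constant `C` at a prime `p`. -/
noncomputable def densityFactor (d : ℕ) [NeZero d] (p : Nat.Primes) : ℝ :=
  1 - (p : ℝ)⁻¹ + ((p : ℝ) + ((quadCharNeg d ((p : ℕ) : ZMod d) : ℤ) : ℝ))⁻¹

/-- The Euler product `C = ∏_p (1 - p⁻¹ + (p + χ_{-d}(p))⁻¹)` over all primes. -/
noncomputable def densityConst (d : ℕ) [NeZero d] : ℝ :=
  ∏' p : Nat.Primes, densityFactor d p

/-- The set of positive integers `n ≡ r (mod a)` with `F(n) < X`. -/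
def countedSet (d : ℕ) [NeZero d] (a : ℕ) (r : ℤ) (X : ℝ) : Set ℕ :=
  {n : ℕ | 0 < n ∧ (n : ℤ) ≡ r [ZMOD (a : ℤ)] ∧ twistedPsi d n < X}

/-! Write `F(n) = n g(n)`, where `g(n)` depends only on the primes dividing `n`. If only the primes
of a finite set `S` are kept in `g`, the count is elementary. Adjoining a prime `p ∤ a` leaves the
integers prime to `p` (proportion `1 - 1/p`) unchanged, and for the multiples of `p` (proportion
`1/p`) it rescales the threshold by `1 / (1 + χ(p)/p)`. Together these give the local factor `1 -
1/p + 1/(p + χ(p))`. Primes dividing `a` divide `d`, so `χ` vanishes there and the congruence does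
not interfere. This is `ncard_psiSet_div_tendsto`.

The passage to all primes needs a truncation error uniform in `X`. Since `g(n) ≥ φ(n)/n`, every
counted `n` satisfies `n < X n/φ(n)`. On such `n` the weight `(n/φ(n))² / (1 + n/X)²` is at least
`1/4`, and its total mass is `O(X)`, which already gives finiteness. Inserting the sum of `2/p` over
the primes `p ∣ n` outside `S` makes the mass `O(δX)`, where `δ` bounds the sums of `1/m²` outside
`S`. By Markov's inequality (`exists_ncard_primeTail_le`), outside a set of size `O(δX/η)`
truncation changes `g` by a factor between `exp(-η)` and `exp(η)`. Letting `X → ∞` for suitable `η`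
and `S` gives the limit. -/

/-! ### Weighted averages of multiplicative functions -/

/-- The partial sums of `1 / (1 + t m)²` over `m ≥ 1` are at most `1 / t`. -/
theorem sum_inv_one_add_mul_sq_le {t : ℝ} (ht : 0 < t) (N : ℕ) :
    ∑ m ∈ Finset.Icc 1 N, ((1 + t * m) ^ 2)⁻¹ ≤ t⁻¹ := by
  -- Each term is at most a difference of consecutive values of `1 / (t (1 + t m))`, so the sum
  -- telescopes. The subtracted term makes the induction close.
  have key : ∑ m ∈ Finset.Icc 1 N, ((1 + t * m) ^ 2)⁻¹ ≤ t⁻¹ - (t * (1 + t * N))⁻¹ := by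
    induction N with
    | zero => simp
    | succ n ih =>
      rw [Finset.sum_Icc_succ_top (by omega)]
      have h0 : (0 : ℝ) ≤ n := n.cast_nonneg
      have h1 : 0 < 1 + t * (n : ℝ) := by positivity
      have h2 : 0 < 1 + t * ((n : ℝ) + 1) := by positivity
      have : ((1 + t * ((n : ℝ) + 1)) ^ 2)⁻¹ ≤
          (t * (1 + t * n))⁻¹ - (t * (1 + t * ((n : ℝ) + 1)))⁻¹ := by
        have e : (t * (1 + t * n))⁻¹ - (t * (1 + t * ((n : ℝ) + 1)))⁻¹ =
            ((1 + t * n) * (1 + t * ((n : ℝ) + 1)))⁻¹ := by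
          field_simp
          ring
        rw [e, sq]
        gcongr
        linarith
      push_cast
      linarith
  have : 0 ≤ (t * (1 + t * (N : ℝ)))⁻¹ := by positivity
  linarith

/-- Interchange of a sum over `n ≤ N` with a sum over the divisors of `n`. -/
theorem sum_Icc_sum_divisors (N : ℕ) (G : ℕ → ℕ → ℝ) :
    ∑ n ∈ Finset.Icc 1 N, ∑ d ∈ n.divisors, G d n =
      ∑ d ∈ Finset.Icc 1 N, ∑ m ∈ Finset.Icc 1 (N / d), G d (d * m) := by
  rw [Finset.sum_sigma', Finset.sum_sigma']
  refine Finset.sum_bij' (fun x _ => ⟨x.2, x.1 / x.2⟩) (fun x _ => ⟨x.1 * x.2, x.1⟩) ?_ ?_ ?_ ?_ ?_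
  · rintro ⟨n, d⟩ h
    simp only [Finset.mem_sigma, Finset.mem_Icc, Nat.mem_divisors] at h ⊢
    obtain ⟨⟨h1, h2⟩, h3, h4⟩ := h
    have hd := Nat.pos_of_dvd_of_pos h3 h1
    have hle := Nat.le_of_dvd h1 h3
    exact ⟨⟨hd, hle.trans h2⟩, Nat.div_pos hle hd, Nat.div_le_div_right h2⟩
  · rintro ⟨d, m⟩ h
    simp only [Finset.mem_sigma, Finset.mem_Icc, Nat.mem_divisors] at h ⊢
    obtain ⟨⟨h1, h2⟩, h3, h4⟩ := h
    have h5 : d * m ≤ N := (Nat.mul_le_mul_left d h4).trans (Nat.mul_div_le N d)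
    have h6 : 0 < d * m := Nat.mul_pos h1 h3
    exact ⟨⟨h6, h5⟩, dvd_mul_right _ _, h6.ne'⟩
  · rintro ⟨n, d⟩ h
    simp only [Finset.mem_sigma, Finset.mem_Icc, Nat.mem_divisors] at h
    simp [Nat.mul_div_cancel' h.2.1]
  · rintro ⟨d, m⟩ h
    simp only [Finset.mem_sigma, Finset.mem_Icc] at h
    simp [Nat.mul_div_cancel_left m h.1.1]
  · rintro ⟨n, d⟩ h
    simp only [Finset.mem_sigma, Finset.mem_Icc, Nat.mem_divisors] at h
    simp [Nat.mul_div_cancel' h.2.1]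

/-- The ratio `n / φ(n) = ∏_{p ∣ n} (1 - p⁻¹)⁻¹`. -/
noncomputable def totientRatio (n : ℕ) : ℝ := ∏ p ∈ n.primeFactors, (1 - (p : ℝ)⁻¹)⁻¹

theorem inv_natCast_prime_le_half {p : ℕ} (hp : p.Prime) : (p : ℝ)⁻¹ ≤ 1 / 2 := by
  have : (2 : ℝ) ≤ p := by exact_mod_cast hp.two_le
  rw [inv_eq_one_div]
  gcongr

theorem inv_natCast_prime_pos {p : ℕ} (hp : p.Prime) : 0 < (p : ℝ)⁻¹ := by
  have : (0 : ℝ) < p := by exact_mod_cast hp.pos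
  positivity

theorem one_le_inv_one_sub_inv_prime {p : ℕ} (hp : p.Prime) : 1 ≤ (1 - (p : ℝ)⁻¹)⁻¹ := by
  have h1 := inv_natCast_prime_le_half hp
  have h2 := inv_natCast_prime_pos hp
  exact (one_le_inv₀ (by linarith)).2 (by linarith)

theorem one_le_totientRatio (n : ℕ) : 1 ≤ totientRatio n :=
  Finset.one_le_prod fun _ hp => one_le_inv_one_sub_inv_prime (Nat.prime_of_mem_primeFactors hp)

/-- A new prime contributes `(1 - 1/p)⁻¹ ≤ 2`. This lets a prime be pulled out of `n = p m` at
bounded cost when sums over `n` are rearranged. -/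
theorem totientRatio_prime_mul_le {p m : ℕ} (hp : p.Prime) (hm : m ≠ 0) :
    totientRatio (p * m) ≤ 2 * totientRatio m := by
  have h1 := inv_natCast_prime_le_half hp
  have h0 : 0 ≤ totientRatio m := zero_le_one.trans (one_le_totientRatio m)
  by_cases hpm : p ∈ m.primeFactors
  · have : (p * m).primeFactors = m.primeFactors := by
      rw [Nat.primeFactors_mul hp.ne_zero hm, hp.primeFactors]
      simpa using hpm
    rw [totientRatio, this, ← totientRatio]
    linarith
  · have : (p * m).primeFactors = insert p m.primeFactors := by
      rw [Nat.primeFactors_mul hp.ne_zero hm, hp.primeFactors]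
      rfl
    rw [totientRatio, this, Finset.prod_insert hpm, ← totientRatio]
    gcongr
    rw [inv_le_comm₀ (by linarith) (by norm_num)]
    linarith

/-- Expanding the product gives the sum of `1/d` over the squarefree divisors; a squarefree number
determines its set of primes, so no divisor is counted twice. -/
theorem prod_one_add_inv_primeFactors_le {n : ℕ} (hn : n ≠ 0) :
    ∏ p ∈ n.primeFactors, (1 + (p : ℝ)⁻¹) ≤ ∑ d ∈ n.divisors, (d : ℝ)⁻¹ := by
  rw [Finset.prod_one_add]
  have hinj : Set.InjOn (fun t : Finset ℕ => ∏ p ∈ t, p) (n.primeFactors.powerset : Set (Finset ℕ)) := by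
    intro s hs t ht h
    simp only [Finset.coe_powerset, Set.mem_preimage, Set.mem_powerset_iff, Finset.coe_subset] at hs ht
    rw [← Nat.primeFactors_prod fun p hp => Nat.prime_of_mem_primeFactors (hs hp),
      ← Nat.primeFactors_prod fun p hp => Nat.prime_of_mem_primeFactors (ht hp)]
    exact congrArg _ h
  have : ∑ t ∈ n.primeFactors.powerset, ∏ p ∈ t, (p : ℝ)⁻¹ =
      ∑ d ∈ n.primeFactors.powerset.image (fun t => ∏ p ∈ t, p), (d : ℝ)⁻¹ := by
    rw [Finset.sum_image hinj]
    simp [Finset.prod_inv_distrib]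
  rw [this]
  refine Finset.sum_le_sum_of_subset_of_nonneg ?_ fun _ _ _ => by positivity
  intro d hd
  obtain ⟨t, ht, rfl⟩ := Finset.mem_image.1 hd
  rw [Finset.mem_powerset] at ht
  exact Nat.mem_divisors.2 ⟨(Finset.prod_dvd_prod_of_subset _ _ _ ht).trans
    (Nat.prod_primeFactors_dvd n), hn⟩

/-- For `0 < x ≤ 1/2` one has `(1 - x)⁻¹ ≤ (1 + 2x²)(1 + x)`. With `x = 1/p` the factors `1 + 2x²`
have bounded product, and the factors `1 + x` are bounded by the divisor sum. -/
theorem exists_totientRatio_le :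
    ∃ K : ℝ, 0 < K ∧ ∀ n : ℕ, n ≠ 0 → totientRatio n ≤ K * ∑ d ∈ n.divisors, (d : ℝ)⁻¹ := by
  have hsum : Summable fun n : ℕ => 2 * ((n : ℝ) ^ 2)⁻¹ :=
    (Real.summable_nat_pow_inv.2 one_lt_two).mul_left 2
  refine ⟨Real.exp (∑' n : ℕ, 2 * ((n : ℝ) ^ 2)⁻¹), Real.exp_pos _, fun n hn => ?_⟩
  calc totientRatio n
      ≤ ∏ p ∈ n.primeFactors, Real.exp (2 * ((p : ℝ) ^ 2)⁻¹) * (1 + (p : ℝ)⁻¹) := by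
        refine Finset.prod_le_prod (fun p hp => ?_) fun p hp => ?_
        · exact zero_le_one.trans (one_le_inv_one_sub_inv_prime (Nat.prime_of_mem_primeFactors hp))
        have hp := Nat.prime_of_mem_primeFactors hp
        have h1 := inv_natCast_prime_le_half hp
        have h2 := inv_natCast_prime_pos hp
        rw [← inv_pow]
        set x := (p : ℝ)⁻¹
        have h3 : (1 - x)⁻¹ ≤ (1 + 2 * x ^ 2) * (1 + x) := by
          rw [inv_le_iff_one_le_mul₀ (by linarith)]
          have : (1 + 2 * x ^ 2) * (1 + x) * (1 - x) = 1 + x ^ 2 * (1 - 2 * x ^ 2) := by ring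
          rw [this]
          have : 0 ≤ x ^ 2 * (1 - 2 * x ^ 2) := mul_nonneg (sq_nonneg x) (by nlinarith)
          linarith
        refine h3.trans ?_
        gcongr
        linarith [Real.add_one_le_exp (2 * x ^ 2)]
    _ = Real.exp (∑ p ∈ n.primeFactors, 2 * ((p : ℝ) ^ 2)⁻¹) *
          ∏ p ∈ n.primeFactors, (1 + (p : ℝ)⁻¹) := by
        rw [Finset.prod_mul_distrib, Real.exp_sum]
    _ ≤ _ := by
        gcongr
        · exact hsum.sum_le_tsum _ fun _ _ => by positivity
        · exact prod_one_add_inv_primeFactors_le hn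

/-- Cauchy–Schwarz with the splitting `d⁻² = d^(-3/2) d^(-1/2)` replaces the square by a single
divisor sum. The exponent `-1/2` suffices because summing over multiples of `d` later contributes
another `1/d`. -/
theorem exists_totientRatio_sq_le : ∃ K : ℝ, 0 < K ∧ ∀ n : ℕ, n ≠ 0 →
    totientRatio n ^ 2 ≤ K * ∑ d ∈ n.divisors, (d : ℝ) ^ (-(1 / 2) : ℝ) := by
  obtain ⟨K, hK, h⟩ := exists_totientRatio_le
  have hsum : Summable fun n : ℕ => (n : ℝ) ^ (-(3 / 2) : ℝ) :=
    Real.summable_nat_rpow.2 (by norm_num)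
  have hnn : 0 ≤ ∑' n : ℕ, (n : ℝ) ^ (-(3 / 2) : ℝ) := tsum_nonneg fun _ => by positivity
  refine ⟨K ^ 2 * (1 + ∑' n : ℕ, (n : ℝ) ^ (-(3 / 2) : ℝ)), by positivity, fun n hn => ?_⟩
  have hH : 0 ≤ totientRatio n := zero_le_one.trans (one_le_totientRatio n)
  calc totientRatio n ^ 2 ≤ (K * ∑ d ∈ n.divisors, (d : ℝ)⁻¹) ^ 2 := by
        gcongr
        exact h n hn
    _ = K ^ 2 * (∑ d ∈ n.divisors, (d : ℝ)⁻¹) ^ 2 := mul_pow _ _ _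
    _ ≤ K ^ 2 * ((∑ d ∈ n.divisors, (d : ℝ) ^ (-(3 / 2) : ℝ)) *
          ∑ d ∈ n.divisors, (d : ℝ) ^ (-(1 / 2) : ℝ)) := by
        gcongr
        refine Finset.sum_sq_le_sum_mul_sum_of_sq_le_mul _ (fun _ _ => by positivity)
          (fun _ _ => by positivity) fun d hd => le_of_eq ?_
        have hd : (0 : ℝ) < d := by exact_mod_cast Nat.pos_of_mem_divisors hd
        rw [← Real.rpow_add hd, inv_pow, ← Real.rpow_natCast, ← Real.rpow_neg hd.le]
        norm_num
    _ ≤ K ^ 2 * ((1 + ∑' n : ℕ, (n : ℝ) ^ (-(3 / 2) : ℝ)) *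
          ∑ d ∈ n.divisors, (d : ℝ) ^ (-(1 / 2) : ℝ)) := by
        gcongr
        have := hsum.sum_le_tsum n.divisors fun _ _ => by positivity
        linarith
    _ = _ := by ring

/-- The weighted second moment of `n / φ(n)` is bounded. -/
theorem exists_sum_totientRatio_sq_le : ∃ M : ℝ, 0 < M ∧ ∀ (t : ℝ) (N : ℕ), 0 < t →
    ∑ n ∈ Finset.Icc 1 N, totientRatio n ^ 2 * ((1 + t * n) ^ 2)⁻¹ ≤ M / t := by
  obtain ⟨K, hK, h⟩ := exists_totientRatio_sq_le
  have hsum : Summable fun n : ℕ => (n : ℝ) ^ (-(3 / 2) : ℝ) :=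
    Real.summable_nat_rpow.2 (by norm_num)
  have hnn : 0 ≤ ∑' n : ℕ, (n : ℝ) ^ (-(3 / 2) : ℝ) := tsum_nonneg fun _ => by positivity
  refine ⟨K * (1 + ∑' n : ℕ, (n : ℝ) ^ (-(3 / 2) : ℝ)), by positivity, fun t N ht => ?_⟩
  calc ∑ n ∈ Finset.Icc 1 N, totientRatio n ^ 2 * ((1 + t * n) ^ 2)⁻¹
      ≤ ∑ n ∈ Finset.Icc 1 N, K * (∑ d ∈ n.divisors, (d : ℝ) ^ (-(1 / 2) : ℝ) *
          ((1 + t * n) ^ 2)⁻¹) := by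
        refine Finset.sum_le_sum fun n hn => ?_
        rw [← Finset.sum_mul, ← mul_assoc]
        gcongr
        exact h n (by have := Finset.mem_Icc.1 hn; omega)
    _ = K * ∑ d ∈ Finset.Icc 1 N, ∑ m ∈ Finset.Icc 1 (N / d), (d : ℝ) ^ (-(1 / 2) : ℝ) *
          ((1 + t * (d * m : ℕ)) ^ 2)⁻¹ := by
        rw [← Finset.mul_sum,
          sum_Icc_sum_divisors N fun d n => (d : ℝ) ^ (-(1 / 2) : ℝ) * ((1 + t * n) ^ 2)⁻¹]
    _ ≤ K * ∑ d ∈ Finset.Icc 1 N, (d : ℝ) ^ (-(3 / 2) : ℝ) * t⁻¹ := by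
        gcongr with d hd
        have hd : (0 : ℝ) < d := by exact_mod_cast (Finset.mem_Icc.1 hd).1
        rw [← Finset.mul_sum]
        have h1 := sum_inv_one_add_mul_sq_le (mul_pos ht hd) (N / d)
        calc _ ≤ (d : ℝ) ^ (-(1 / 2) : ℝ) * (t * d)⁻¹ := by
              gcongr
              simpa [mul_assoc] using h1
          _ = (d : ℝ) ^ (-(1 / 2) : ℝ) * (d : ℝ) ^ (-1 : ℝ) * t⁻¹ := by
              rw [mul_inv, Real.rpow_neg_one]; ring
          _ = _ := by rw [← Real.rpow_add hd]; norm_num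
    _ ≤ K * ((1 + ∑' n : ℕ, (n : ℝ) ^ (-(3 / 2) : ℝ)) * t⁻¹) := by
        rw [← Finset.sum_mul]
        gcongr
        have := hsum.sum_le_tsum (Finset.Icc 1 N) fun _ _ => by positivity
        linarith
    _ = _ := by ring

/-- The sum of `2 / p` over the primes `p ∣ n` outside `S`. -/
noncomputable def primeTail (S : Finset ℕ) (n : ℕ) : ℝ := ∑ p ∈ n.primeFactors \ S, 2 * (p : ℝ)⁻¹

theorem primeTail_nonneg (S : Finset ℕ) (n : ℕ) : 0 ≤ primeTail S n :=
  Finset.sum_nonneg fun _ _ => by positivity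

/-- Interchange the sums and write `n = p m`. The multiples of `p` have weighted mass at most `4 M /
(t p)`, so the coefficient `2/p` turns into `8 M / (t p²)`, which is summable over `p ∉ S`. -/
theorem exists_sum_primeTail_mul_le : ∃ M : ℝ, 0 < M ∧
    ∀ (S : Finset ℕ) (δ t : ℝ) (N : ℕ), 0 < t →
    (∀ u : Finset ℕ, Disjoint u S → ∑ p ∈ u, ((p : ℝ) ^ 2)⁻¹ ≤ δ) →
    ∑ n ∈ Finset.Icc 1 N, primeTail S n * (totientRatio n ^ 2 * ((1 + t * n) ^ 2)⁻¹) ≤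
      M * δ / t := by
  obtain ⟨M, hM, h⟩ := exists_sum_totientRatio_sq_le
  refine ⟨8 * M, by positivity, fun S δ t N ht hδ => ?_⟩
  let c : ℕ → ℝ := fun p => if p.Prime ∧ p ∉ S then 2 * (p : ℝ)⁻¹ else 0
  have hc : ∀ n ∈ Finset.Icc 1 N, primeTail S n = ∑ d ∈ n.divisors, c d := by
    intro n hn
    have hn : n ≠ 0 := by have := Finset.mem_Icc.1 hn; omega
    rw [← Finset.sum_filter, primeTail]
    congr 1
    ext p
    simp only [Finset.mem_sdiff, Nat.mem_primeFactors, Finset.mem_filter, Nat.mem_divisors]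
    tauto
  calc _ = ∑ n ∈ Finset.Icc 1 N, ∑ d ∈ n.divisors,
          c d * (totientRatio n ^ 2 * ((1 + t * n) ^ 2)⁻¹) := by
        refine Finset.sum_congr rfl fun n hn => ?_
        rw [hc n hn, Finset.sum_mul]
    _ = ∑ d ∈ Finset.Icc 1 N, ∑ m ∈ Finset.Icc 1 (N / d),
          c d * (totientRatio (d * m) ^ 2 * ((1 + t * (d * m : ℕ)) ^ 2)⁻¹) :=
        sum_Icc_sum_divisors N fun d n => c d * (totientRatio n ^ 2 * ((1 + t * n) ^ 2)⁻¹)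
    _ ≤ ∑ d ∈ Finset.Icc 1 N, if d.Prime ∧ d ∉ S then 8 * M / t * ((d : ℝ) ^ 2)⁻¹ else 0 := by
        refine Finset.sum_le_sum fun p _ => ?_
        by_cases hp : p.Prime ∧ p ∉ S
        · simp only [c, if_pos hp]
          have hp0 : (0 : ℝ) < p := by exact_mod_cast hp.1.pos
          rw [← Finset.mul_sum]
          calc _ ≤ 2 * (p : ℝ)⁻¹ * ∑ m ∈ Finset.Icc 1 (N / p),
                4 * (totientRatio m ^ 2 * ((1 + t * p * m) ^ 2)⁻¹) := by
                refine mul_le_mul_of_nonneg_left (Finset.sum_le_sum fun m hm => ?_) (by positivity)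
                have hm : m ≠ 0 := by have := Finset.mem_Icc.1 hm; omega
                have h0 : 0 ≤ totientRatio (p * m) := zero_le_one.trans (one_le_totientRatio _)
                calc _ ≤ (2 * totientRatio m) ^ 2 * ((1 + t * (p * m : ℕ)) ^ 2)⁻¹ := by
                      gcongr
                      exact totientRatio_prime_mul_le hp.1 hm
                  _ = _ := by push_cast; ring
            _ ≤ 2 * (p : ℝ)⁻¹ * (4 * (M / (t * p))) := by
                rw [← Finset.mul_sum]
                gcongr
                exact h (t * p) (N / p) (by positivity)
            _ = _ := by field_simp; ring
        · simp [c, if_neg hp]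
    _ = 8 * M / t * ∑ p ∈ Finset.Icc 1 N with p.Prime ∧ p ∉ S, ((p : ℝ) ^ 2)⁻¹ := by
        rw [← Finset.sum_filter, ← Finset.mul_sum]
    _ ≤ 8 * M / t * δ := by
        gcongr
        refine hδ _ (Finset.disjoint_left.2 fun p hp => ?_)
        exact (Finset.mem_filter.1 hp).2.2
    _ = _ := by ring

theorem finite_and_ncard_le_of_sum_le {s : Set ℕ} {w : ℕ → ℝ} {B : ℝ} (hw : ∀ n, 0 ≤ w n)
    (hB : ∀ N, ∑ n ∈ Finset.Icc 1 N, w n ≤ B) (hs : ∀ n ∈ s, 0 < n ∧ 1 ≤ w n) :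
    s.Finite ∧ (s.ncard : ℝ) ≤ B := by
  have key : ∀ u : Finset ℕ, (u : Set ℕ) ⊆ s → (u.card : ℝ) ≤ B := by
    intro u hu
    refine le_trans ?_ (hB (u.sup id))
    calc (u.card : ℝ) = ∑ n ∈ u, (1 : ℝ) := by simp
      _ ≤ ∑ n ∈ u, w n := Finset.sum_le_sum fun n hn => (hs n (hu hn)).2
      _ ≤ _ := Finset.sum_le_sum_of_subset_of_nonneg (fun n hn => Finset.mem_Icc.2
          ⟨(hs n (hu hn)).1, Finset.le_sup (f := id) hn⟩) fun n _ _ => hw n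
  have hfin : s.Finite := by
    by_contra hinf
    obtain ⟨u, hu, hcard⟩ := Set.Infinite.exists_subset_card_eq hinf (⌊B⌋₊ + 1)
    have := key u hu
    rw [hcard] at this
    push_cast at this
    linarith [Nat.lt_floor_add_one B]
  refine ⟨hfin, ?_⟩
  rw [Set.ncard_eq_toFinset_card s hfin]
  exact key _ (by simp)

/-- Both `1` and `n/X` are at most the ratio, so `1 + n/X` is at most twice it; squaring gives the
constant `4`. The weight replaces a cutoff that depends on `n` irregularly. -/
theorem one_le_totientRatio_weight {n : ℕ} {X : ℝ} (hX : 0 < X) (h : (n : ℝ) < X * totientRatio n) :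
    1 ≤ 4 * (totientRatio n ^ 2 * ((1 + X⁻¹ * n) ^ 2)⁻¹) := by
  have h1 := one_le_totientRatio n
  have h2 : X⁻¹ * n < totientRatio n := by
    rwa [inv_mul_lt_iff₀ hX]
  have h3 : 0 ≤ X⁻¹ * n := by positivity
  rw [← mul_assoc, ← div_eq_mul_inv, one_le_div (by positivity)]
  calc (1 + X⁻¹ * n) ^ 2 ≤ (totientRatio n + totientRatio n) ^ 2 := by gcongr
    _ = _ := by ring

theorem finite_setOf_lt_mul_totientRatio (X : ℝ) :
    {n : ℕ | 0 < n ∧ (n : ℝ) < X * totientRatio n}.Finite := by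
  rcases le_or_gt X 0 with hX | hX
  · convert Set.finite_empty
    ext n
    simp only [Set.mem_ofPred_eq, Set.mem_empty_iff_false, iff_false, not_and, not_lt]
    intro _
    have := one_le_totientRatio n
    exact (mul_nonpos_of_nonpos_of_nonneg hX (by linarith)).trans n.cast_nonneg
  obtain ⟨M, hM, h⟩ := exists_sum_totientRatio_sq_le
  refine (finite_and_ncard_le_of_sum_le
    (w := fun n => 4 * (totientRatio n ^ 2 * ((1 + X⁻¹ * n) ^ 2)⁻¹)) (B := 4 * (M / X⁻¹))
    (fun n => by positivity) (fun N => ?_) fun n hn => ?_).1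
  · rw [← Finset.mul_sum]
    gcongr
    exact h _ N (by positivity)
  · exact ⟨hn.1, one_le_totientRatio_weight hX hn.2⟩

theorem exists_ncard_primeTail_le : ∃ M : ℝ, 0 < M ∧ ∀ (S : Finset ℕ) (δ η X : ℝ), 0 < X → 0 < η →
    (∀ u : Finset ℕ, Disjoint u S → ∑ p ∈ u, ((p : ℝ) ^ 2)⁻¹ ≤ δ) →
    ({n : ℕ | 0 < n ∧ (n : ℝ) < X * totientRatio n ∧ η ≤ primeTail S n}.ncard : ℝ) ≤
      M * δ / η * X := by
  obtain ⟨M, hM, h⟩ := exists_sum_primeTail_mul_le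
  refine ⟨4 * M, by positivity, fun S δ η X hX hη hδ => ?_⟩
  refine (finite_and_ncard_le_of_sum_le
    (w := fun n => 4 / η * (primeTail S n * (totientRatio n ^ 2 * ((1 + X⁻¹ * n) ^ 2)⁻¹)))
    (fun n => ?_) (fun N => ?_) fun n hn => ?_).2
  · have := primeTail_nonneg S n
    positivity
  · rw [← Finset.mul_sum]
    calc _ ≤ 4 / η * (M * δ / X⁻¹) := by
          gcongr
          exact h S δ _ N (by positivity) hδ
      _ = _ := by field_simp
  · obtain ⟨h0, h1, h2⟩ := hn
    refine ⟨h0, ?_⟩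
    have h3 := one_le_totientRatio_weight hX h1
    have h4 : 1 ≤ primeTail S n / η := (one_le_div hη).2 h2
    calc (1 : ℝ) ≤ primeTail S n / η * (4 * (totientRatio n ^ 2 * ((1 + X⁻¹ * n) ^ 2)⁻¹)) :=
          one_le_mul_of_one_le_of_one_le h4 h3
      _ = _ := by ring

/-! ### Counting with finitely many local conditions -/

/-- The product of `1 + f(p) / p` over the primes `p ∈ S` dividing `n`. -/
noncomputable def psiRatio (f : ℕ → ℝ) (S : Finset ℕ) (n : ℕ) : ℝ :=
  ∏ p ∈ n.primeFactors ∩ S, (1 + f p * (p : ℝ)⁻¹)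

theorem abs_mul_inv_prime_le_half {f : ℕ → ℝ} (hf : ∀ p, |f p| ≤ 1) {p : ℕ} (hp : p.Prime) :
    |f p * (p : ℝ)⁻¹| ≤ 1 / 2 := by
  rw [abs_mul, abs_of_pos (inv_natCast_prime_pos hp)]
  calc |f p| * (p : ℝ)⁻¹ ≤ 1 * (1 / 2) := by
        gcongr
        · exact hf p
        · exact inv_natCast_prime_le_half hp
    _ = 1 / 2 := one_mul _

theorem one_add_mul_inv_prime_pos {f : ℕ → ℝ} (hf : ∀ p, |f p| ≤ 1) {p : ℕ} (hp : p.Prime) :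
    0 < 1 + f p * (p : ℝ)⁻¹ := by
  have := (abs_le.1 (abs_mul_inv_prime_le_half hf hp)).1
  linarith

theorem one_sub_inv_le_one_add_mul_inv {f : ℕ → ℝ} (hf : ∀ p, |f p| ≤ 1) (p : ℕ) :
    1 - (p : ℝ)⁻¹ ≤ 1 + f p * (p : ℝ)⁻¹ := by
  have h1 := (abs_le.1 (hf p)).1
  have h2 : 0 ≤ (p : ℝ)⁻¹ := by positivity
  nlinarith

theorem psiRatio_pos {f : ℕ → ℝ} (hf : ∀ p, |f p| ≤ 1) (S : Finset ℕ) (n : ℕ) :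
    0 < psiRatio f S n :=
  Finset.prod_pos fun _ hp => one_add_mul_inv_prime_pos hf
    (Nat.prime_of_mem_primeFactors (Finset.mem_inter.1 hp).1)

/-- The worst case is `f = -1`, and the factors of `totientRatio n` outside `S` are at least `1`.
Hence truncated and full counts are both confined to `n < X * totientRatio n`, whatever `S` is. -/
theorem one_le_psiRatio_mul_totientRatio {f : ℕ → ℝ} (hf : ∀ p, |f p| ≤ 1) (S : Finset ℕ) (n : ℕ) :
    1 ≤ psiRatio f S n * totientRatio n := by
  have h1 : ∏ p ∈ n.primeFactors ∩ S, (1 - (p : ℝ)⁻¹)⁻¹ ≤ totientRatio n :=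
    Finset.prod_le_prod_of_subset_of_one_le Finset.inter_subset_left
      (fun p hp => zero_le_one.trans (one_le_inv_one_sub_inv_prime
        (Nat.prime_of_mem_primeFactors (Finset.mem_inter.1 hp).1)))
      fun p hp _ => one_le_inv_one_sub_inv_prime (Nat.prime_of_mem_primeFactors hp)
  have h2 : 1 ≤ psiRatio f S n * ∏ p ∈ n.primeFactors ∩ S, (1 - (p : ℝ)⁻¹)⁻¹ := by
    rw [psiRatio, ← Finset.prod_mul_distrib]
    refine Finset.one_le_prod fun p hp => ?_
    have hp := Nat.prime_of_mem_primeFactors (Finset.mem_inter.1 hp).1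
    have := inv_natCast_prime_le_half hp
    rw [← div_eq_mul_inv, one_le_div (by linarith)]
    exact one_sub_inv_le_one_add_mul_inv hf p
  exact h2.trans (mul_le_mul_of_nonneg_left h1 (psiRatio_pos hf S n).le)

/-- It follows from `(1 + 2|x|)(1 - |x|) ≥ 1`. This lower bound is the source of the coefficient `2`
in `primeTail`. -/
theorem exp_neg_le_one_add {x : ℝ} (hx : |x| ≤ 1 / 2) : Real.exp (-(2 * |x|)) ≤ 1 + x := by
  have h1 := Real.add_one_le_exp (2 * |x|)
  have h2 := neg_abs_le x
  have h3 := abs_nonneg x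
  rw [Real.exp_neg, inv_le_iff_one_le_mul₀ (Real.exp_pos _)]
  nlinarith

theorem psiRatio_primeFactors_eq (f : ℕ → ℝ) (S : Finset ℕ) (n : ℕ) :
    psiRatio f n.primeFactors n =
      psiRatio f S n * ∏ p ∈ n.primeFactors \ S, (1 + f p * (p : ℝ)⁻¹) := by
  rw [psiRatio, psiRatio, Finset.inter_self, Finset.prod_inter_mul_prod_sdiff]

theorem prod_sdiff_le_exp_primeTail {f : ℕ → ℝ} (hf : ∀ p, |f p| ≤ 1) (S : Finset ℕ) (n : ℕ) :
    ∏ p ∈ n.primeFactors \ S, (1 + f p * (p : ℝ)⁻¹) ≤ Real.exp (primeTail S n) := by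
  rw [primeTail, Real.exp_sum]
  refine Finset.prod_le_prod (fun p hp => ?_) fun p hp => ?_
  · exact (one_add_mul_inv_prime_pos hf
      (Nat.prime_of_mem_primeFactors (Finset.mem_sdiff.1 hp).1)).le
  · have h1 := (abs_le.1 (hf p)).2
    have h2 : 0 ≤ (p : ℝ)⁻¹ := by positivity
    have h3 := Real.add_one_le_exp (2 * (p : ℝ)⁻¹)
    nlinarith

theorem exp_neg_primeTail_le_prod_sdiff {f : ℕ → ℝ} (hf : ∀ p, |f p| ≤ 1) (S : Finset ℕ) (n : ℕ) :
    Real.exp (-primeTail S n) ≤ ∏ p ∈ n.primeFactors \ S, (1 + f p * (p : ℝ)⁻¹) := by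
  rw [primeTail, ← Finset.sum_neg_distrib, Real.exp_sum]
  refine Finset.prod_le_prod (fun p hp => (Real.exp_pos _).le) fun p hp => ?_
  have hp := Nat.prime_of_mem_primeFactors (Finset.mem_sdiff.1 hp).1
  refine le_trans (Real.exp_le_exp.2 ?_) (exp_neg_le_one_add (abs_mul_inv_prime_le_half hf hp))
  rw [abs_mul, abs_of_pos (inv_natCast_prime_pos hp)]
  have := mul_le_mul_of_nonneg_right (hf p) (inv_natCast_prime_pos hp).le
  linarith

theorem psiRatio_primeFactors_le {f : ℕ → ℝ} (hf : ∀ p, |f p| ≤ 1) (S : Finset ℕ) (n : ℕ) :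
    psiRatio f n.primeFactors n ≤ psiRatio f S n * Real.exp (primeTail S n) := by
  rw [psiRatio_primeFactors_eq f S]
  exact mul_le_mul_of_nonneg_left (prod_sdiff_le_exp_primeTail hf S n) (psiRatio_pos hf S n).le

theorem psiRatio_le {f : ℕ → ℝ} (hf : ∀ p, |f p| ≤ 1) (S : Finset ℕ) (n : ℕ) :
    psiRatio f S n ≤ psiRatio f n.primeFactors n * Real.exp (primeTail S n) := by
  have h1 := exp_neg_primeTail_le_prod_sdiff hf S n
  rw [Real.exp_neg, inv_le_iff_one_le_mul₀ (Real.exp_pos _)] at h1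
  rw [psiRatio_primeFactors_eq f S, mul_assoc]
  exact le_mul_of_one_le_right (psiRatio_pos hf S n).le h1

/-- The positive integers `n ≡ r (mod a)` such that `n ∏_{p ∣ n, p ∈ S} (1 + f(p) / p) < X`. -/
def psiSet (f : ℕ → ℝ) (S : Finset ℕ) (a : ℕ) (r : ℤ) (X : ℝ) : Set ℕ :=
  {n : ℕ | 0 < n ∧ (n : ℤ) ≡ r [ZMOD (a : ℤ)] ∧ (n : ℝ) * psiRatio f S n < X}

theorem natCast_lt_mul_totientRatio {n : ℕ} {g X : ℝ} (hg : 1 ≤ g * totientRatio n)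
    (h : (n : ℝ) * g < X) : (n : ℝ) < X * totientRatio n := by
  have h0 : 0 < totientRatio n := zero_lt_one.trans_le (one_le_totientRatio n)
  calc (n : ℝ) ≤ n * (g * totientRatio n) := le_mul_of_one_le_right n.cast_nonneg hg
    _ = n * g * totientRatio n := by ring
    _ < _ := by gcongr

theorem psiSet_finite {f : ℕ → ℝ} (hf : ∀ p, |f p| ≤ 1) (S : Finset ℕ) (a : ℕ) (r : ℤ) (X : ℝ) :
    (psiSet f S a r X).Finite :=
  (finite_setOf_lt_mul_totientRatio X).subset fun n hn =>
    ⟨hn.1, natCast_lt_mul_totientRatio (one_le_psiRatio_mul_totientRatio hf S n) hn.2.2⟩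

theorem psiSet_empty_ncard_div_tendsto (f : ℕ → ℝ) {a : ℕ} (ha : 0 < a) (r : ℤ) :
    Tendsto (fun X : ℝ => ((psiSet f ∅ a r X).ncard : ℝ) / X) atTop (nhds (1 / (a : ℝ))) := by
  have ha' : (0 : ℝ) < a := by exact_mod_cast ha
  have hbound : ∀ X : ℝ, 1 ≤ X → |((psiSet f ∅ a r X).ncard : ℝ) - X / a| ≤ 3 := by
    intro X hX
    -- The largest integer strictly below `X`, since the inequality defining the set is strict.
    let b : ℤ := ⌈X⌉ - 1
    have hb1 : X - 1 ≤ b := by push_cast [b]; linarith [Int.le_ceil X]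
    have hb2 : (b : ℝ) < X := by push_cast [b]; linarith [Int.ceil_lt_add_one X]
    have hb0 : 0 ≤ b := by
      have : (0 : ℝ) ≤ b := by linarith
      exact_mod_cast this
    have hset : ((psiSet f ∅ a r X).image ((↑) : ℕ → ℤ)) =
        ((Finset.Ioc (0 : ℤ) b).filter (· ≡ r [ZMOD (a : ℤ)]) : Finset ℤ) := by
      ext x
      simp only [psiSet, psiRatio, Finset.inter_empty, Finset.prod_empty, mul_one, Set.mem_image,
        Set.mem_ofPred_eq, Finset.coe_filter, Finset.mem_Ioc]
      constructor
      · rintro ⟨n, ⟨h1, h2, h3⟩, rfl⟩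
        refine ⟨⟨by exact_mod_cast h1, ?_⟩, h2⟩
        have : (n : ℤ) < ⌈X⌉ := Int.lt_ceil.2 (by exact_mod_cast h3)
        omega
      · rintro ⟨⟨h1, h2⟩, h3⟩
        lift x to ℕ using h1.le
        refine ⟨x, ⟨by exact_mod_cast h1, h3, ?_⟩, rfl⟩
        have : ((x : ℤ) : ℝ) ≤ b := by exact_mod_cast h2
        push_cast at this
        linarith
    rw [← Set.ncard_image_of_injective _ (Nat.cast_injective (R := ℤ)), hset, Set.ncard_coe_finset]
    have hcard := Int.Ioc_filter_modEq_card 0 b (r := (a : ℤ)) (by exact_mod_cast ha) r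
    have h1 := Int.floor_le (((b : ℚ) - r) / ((a : ℤ) : ℚ))
    have h2 := Int.lt_floor_add_one (((b : ℚ) - r) / ((a : ℤ) : ℚ))
    have h3 := Int.floor_le ((((0 : ℤ) : ℚ) - r) / ((a : ℤ) : ℚ))
    have h4 := Int.lt_floor_add_one ((((0 : ℤ) : ℚ) - r) / ((a : ℤ) : ℚ))
    set u := ⌊((b : ℚ) - r) / ((a : ℤ) : ℚ)⌋
    set v := ⌊(((0 : ℤ) : ℚ) - r) / ((a : ℤ) : ℚ)⌋
    have huv : 0 ≤ u - v := by
      have : v ≤ u := by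
        refine Int.floor_le_floor ?_
        gcongr
      omega
    rw [max_eq_left huv] at hcard
    have haQ : (0 : ℚ) < ((a : ℤ) : ℚ) := by exact_mod_cast ha
    have h5 : ((u - v : ℤ) : ℚ) < b / ((a : ℤ) : ℚ) + 1 := by
      have : (b : ℚ) / ((a : ℤ) : ℚ) = (b - r) / ((a : ℤ) : ℚ) - (((0 : ℤ) : ℚ) - r) / ((a : ℤ) : ℚ) := by
        push_cast; ring
      push_cast at *
      linarith
    have h6 : b / ((a : ℤ) : ℚ) - 1 < ((u - v : ℤ) : ℚ) := by
      have : (b : ℚ) / ((a : ℤ) : ℚ) = (b - r) / ((a : ℤ) : ℚ) - (((0 : ℤ) : ℚ) - r) / ((a : ℤ) : ℚ) := by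
        push_cast; ring
      push_cast at *
      linarith
    rw [← hcard] at h5 h6
    have h5' : (((Finset.Ioc (0 : ℤ) b).filter (· ≡ r [ZMOD (a : ℤ)])).card : ℝ) < b / a + 1 := by
      exact_mod_cast h5
    have h6' : (b : ℝ) / a - 1 < ((Finset.Ioc (0 : ℤ) b).filter (· ≡ r [ZMOD (a : ℤ)])).card := by
      exact_mod_cast h6
    have ha1 : (1 : ℝ) ≤ a := by exact_mod_cast ha
    have h7 : (b : ℝ) / a ≤ X / a := by gcongr
    have h8 : X / a - 1 ≤ (b : ℝ) / a := by
      have : X / a - 1 / a ≤ (b : ℝ) / a := by rw [← sub_div]; gcongr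
      have : 1 / (a : ℝ) ≤ 1 := (div_le_one ha').2 ha1
      linarith
    rw [abs_le]
    constructor <;> linarith
  have hlim : Tendsto (fun X : ℝ => 3 / X) atTop (nhds 0) := tendsto_const_nhds.div_atTop tendsto_id
  rw [tendsto_iff_norm_sub_tendsto_zero]
  refine squeeze_zero' (Eventually.of_forall fun _ => norm_nonneg _) ?_ hlim
  filter_upwards [eventually_ge_atTop 1] with X hX
  have hX0 : 0 < X := by linarith
  have : ((psiSet f ∅ a r X).ncard : ℝ) / X - 1 / a =
      (((psiSet f ∅ a r X).ncard : ℝ) - X / a) / X := by field_simp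
  rw [this, Real.norm_eq_abs, abs_div, abs_of_pos hX0]
  gcongr
  exact hbound X hX

/-- The local factor `1 - 1 / p + 1 / (p + f(p))` at a prime `p`, and `1` elsewhere. -/
noncomputable def localDensity (f : ℕ → ℝ) (p : ℕ) : ℝ :=
  if p.Prime then 1 - (p : ℝ)⁻¹ + ((p : ℝ) + f p)⁻¹ else 1

theorem psiRatio_insert_of_not_dvd (f : ℕ → ℝ) (S : Finset ℕ) {p n : ℕ} (h : ¬p ∣ n) :
    psiRatio f (insert p S) n = psiRatio f S n := by
  rw [psiRatio, psiRatio, Finset.inter_insert_of_notMem]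
  exact fun hp => h (Nat.dvd_of_mem_primeFactors hp)

theorem psiRatio_insert_of_dvd (f : ℕ → ℝ) {S : Finset ℕ} {p n : ℕ} (hp : p.Prime) (hn : n ≠ 0)
    (hS : p ∉ S) (h : p ∣ n) :
    psiRatio f (insert p S) n = (1 + f p * (p : ℝ)⁻¹) * psiRatio f S n := by
  rw [psiRatio, psiRatio, Finset.inter_insert_of_mem (Nat.mem_primeFactors.2 ⟨hp, h, hn⟩),
    Finset.prod_insert fun h' => hS (Finset.mem_inter.1 h').2]

theorem psiRatio_insert_of_not_prime (f : ℕ → ℝ) (S : Finset ℕ) {p : ℕ} (hp : ¬p.Prime) (n : ℕ) :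
    psiRatio f (insert p S) n = psiRatio f S n := by
  rw [psiRatio, psiRatio, Finset.inter_insert_of_notMem]
  exact fun h => hp (Nat.prime_of_mem_primeFactors h)

theorem psiRatio_insert_of_eq_zero {f : ℕ → ℝ} {S : Finset ℕ} {p : ℕ} (hS : p ∉ S) (hp : f p = 0)
    (n : ℕ) : psiRatio f (insert p S) n = psiRatio f S n := by
  by_cases h : p ∈ n.primeFactors
  · rw [psiRatio_insert_of_dvd f (Nat.prime_of_mem_primeFactors h) (Nat.mem_primeFactors.1 h).2.2 hS
      (Nat.dvd_of_mem_primeFactors h), hp, zero_mul, add_zero, one_mul]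
  · rw [psiRatio, psiRatio, Finset.inter_insert_of_notMem h]

/-- Adjoining a prime `p ∤ a` to `S` splits the count according to whether `p ∣ n`. -/
theorem ncard_psiSet_insert {f : ℕ → ℝ} (hf : ∀ p, |f p| ≤ 1) {S : Finset ℕ} {p a : ℕ} {r s : ℤ}
    (hp : p.Prime) (hS : p ∉ S) (hpa : ¬p ∣ a) (hsr : s ≡ r [ZMOD (a : ℤ)]) (hsp : (p : ℤ) ∣ s)
    (X : ℝ) :
    ((psiSet f (insert p S) a r X).ncard : ℝ) = (psiSet f S a r X).ncard -
      (psiSet f S (p * a) s X).ncard +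
        (psiSet f S (p * a) s (X / (1 + f p * (p : ℝ)⁻¹))).ncard := by
  have hpos := one_add_mul_inv_prime_pos hf hp
  have hcong : ∀ n : ℕ, (n : ℤ) ≡ s [ZMOD ((p * a : ℕ) : ℤ)] ↔
      (n : ℤ) ≡ r [ZMOD (a : ℤ)] ∧ p ∣ n := by
    intro n
    rw [Nat.cast_mul, ← Int.modEq_and_modEq_iff_modEq_mul
      (by simpa using (Nat.Prime.coprime_iff_not_dvd hp).2 hpa)]
    have h0 : s ≡ 0 [ZMOD (p : ℤ)] := (Int.modEq_zero_iff_dvd).2 hsp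
    constructor
    · rintro ⟨h1, h2⟩
      exact ⟨h2.trans hsr, by exact_mod_cast Int.modEq_zero_iff_dvd.1 (h1.trans h0)⟩
    · rintro ⟨h1, h2⟩
      exact ⟨(Int.modEq_zero_iff_dvd.2 (by exact_mod_cast h2)).trans h0.symm, h1.trans hsr.symm⟩
  have hsub : psiSet f S (p * a) s X ⊆ psiSet f S a r X := fun n hn =>
    ⟨hn.1, ((hcong n).1 hn.2.1).1, hn.2.2⟩
  -- By the Chinese remainder theorem the class of `s` mod `p * a` consists of the multiples of `p`
  -- in the class of `r` mod `a`. They are removed and put back with the rescaled threshold.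
  have hunion : psiSet f (insert p S) a r X = (psiSet f S a r X \ psiSet f S (p * a) s X) ∪
      psiSet f S (p * a) s (X / (1 + f p * (p : ℝ)⁻¹)) := by
    ext n
    simp only [psiSet, Set.mem_union, Set.mem_sdiff, Set.mem_ofPred_eq, hcong]
    by_cases hn : p ∣ n
    · by_cases h0 : 0 < n
      · rw [psiRatio_insert_of_dvd f hp h0.ne' hS hn, lt_div_iff₀ hpos]
        have : (n : ℝ) * ((1 + f p * (p : ℝ)⁻¹) * psiRatio f S n) =
          n * psiRatio f S n * (1 + f p * (p : ℝ)⁻¹) := by ring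
        rw [this]
        tauto
      · simp [h0]
    · rw [psiRatio_insert_of_not_dvd f S hn]
      tauto
  have hdisj : Disjoint (psiSet f S a r X \ psiSet f S (p * a) s X)
      (psiSet f S (p * a) s (X / (1 + f p * (p : ℝ)⁻¹))) := by
    rw [Set.disjoint_left]
    rintro n ⟨h1, h2⟩ h3
    exact h2 ⟨h1.1, h3.2.1, h1.2.2⟩
  rw [hunion, Set.ncard_union_eq hdisj ((psiSet_finite hf _ _ _ _).sdiff)
    (psiSet_finite hf _ _ _ _), Nat.cast_add, Set.cast_ncard_sdiff hsub (psiSet_finite hf _ _ _ _)]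

/-- Induction on `S` with the progression left free, because adjoining `p` calls for the modulus `p
* a` as well as `a`. If `p` is not prime, or divides `a` (so `f p = 0`), the local factor is `1` and
the set is unchanged. -/
theorem ncard_psiSet_div_tendsto {f : ℕ → ℝ} (hf : ∀ p, |f p| ≤ 1) (S : Finset ℕ) :
    ∀ (a : ℕ) (r : ℤ), 0 < a → (∀ p ∈ S, p.Prime → p ∣ a → f p = 0) →
    Tendsto (fun X : ℝ => ((psiSet f S a r X).ncard : ℝ) / X) atTop
      (nhds ((∏ p ∈ S, localDensity f p) / a)) := by
  induction S using Finset.induction_on with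
  | empty =>
    intro a r ha _
    simpa using psiSet_empty_ncard_div_tendsto f ha r
  | insert p S hpS ih =>
    intro a r ha hfa
    have hfS : ∀ q ∈ S, q.Prime → q ∣ a → f q = 0 := fun q hq =>
      hfa q (Finset.mem_insert_of_mem hq)
    rw [Finset.prod_insert hpS]
    by_cases hp : p.Prime
    swap
    · simpa [psiSet, psiRatio_insert_of_not_prime f S hp, localDensity, if_neg hp] using ih a r ha hfS
    by_cases hpa : p ∣ a
    · have h0 := hfa p (Finset.mem_insert_self p S) hp hpa
      simpa [psiSet, psiRatio_insert_of_eq_zero hpS h0, localDensity, if_pos hp, h0] using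
        ih a r ha hfS
    have hcop : IsCoprime (p : ℤ) (a : ℤ) :=
      Nat.isCoprime_iff_coprime.2 ((Nat.Prime.coprime_iff_not_dvd hp).2 hpa)
    obtain ⟨s, hsr, hsp⟩ : ∃ s : ℤ, s ≡ r [ZMOD (a : ℤ)] ∧ (p : ℤ) ∣ s := by
      obtain ⟨u, v, huv⟩ := hcop
      -- Bézout: `u p + v a = 1`, so `u p` is `1` mod `a` and `0` mod `p`.
      refine ⟨r * (u * p), ?_, ⟨r * u, by ring⟩⟩
      rw [Int.modEq_iff_dvd]
      exact ⟨r * v, by linear_combination (-r) * huv⟩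
    have hpos := one_add_mul_inv_prime_pos hf hp
    have hp0 : (0 : ℝ) < p := by exact_mod_cast hp.pos
    have ha0 : (0 : ℝ) < a := by exact_mod_cast ha
    -- The hypothesis passes to the modulus `p * a` because `p ∉ S`.
    have hfpa : ∀ q ∈ S, q.Prime → q ∣ p * a → f q = 0 := by
      intro q hq hqp hqa
      rcases (Nat.Prime.dvd_mul hqp).1 hqa with h | h
      · exact absurd hq ((Nat.prime_dvd_prime_iff_eq hqp hp).1 h ▸ hpS)
      · exact hfS q hq hqp h
    have h1 := ih a r ha hfS
    have h2 := ih (p * a) s (Nat.mul_pos hp.pos ha) hfpa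
    have h3 := (h2.comp (tendsto_id.atTop_div_const hpos)).div_const (1 + f p * (p : ℝ)⁻¹)
    have hlim : localDensity f p * ∏ q ∈ S, localDensity f q =
        (∏ q ∈ S, localDensity f q) * (1 - (p : ℝ)⁻¹ + (p : ℝ)⁻¹ / (1 + f p * (p : ℝ)⁻¹)) := by
      have h4 : (p : ℝ) + f p = p * (1 + f p * (p : ℝ)⁻¹) := by field_simp
      rw [localDensity, if_pos hp, mul_comm, h4, mul_inv, div_eq_mul_inv]
    rw [hlim]
    have h5 := (h1.sub h2).add h3
    have e : (∏ q ∈ S, localDensity f q) * (1 - (p : ℝ)⁻¹ + (p : ℝ)⁻¹ / (1 + f p * (p : ℝ)⁻¹)) / a =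
        (∏ q ∈ S, localDensity f q) / a - (∏ q ∈ S, localDensity f q) / (p * a : ℕ) +
          (∏ q ∈ S, localDensity f q) / (p * a : ℕ) / (1 + f p * (p : ℝ)⁻¹) := by
      push_cast
      field_simp
    rw [e]
    refine h5.congr' ?_
    filter_upwards [eventually_gt_atTop 0] with X hX
    rw [ncard_psiSet_insert hf hp hpS hpa hsr hsp X]
    simp only [Function.comp_apply, id_eq]
    rw [add_div, sub_div, div_div _ (X / _), div_mul_cancel₀ _ hpos.ne']

/-! ### Passage to the full product -/

/-- The positive integers `n ≡ r (mod a)` such that `n ∏_{p ∣ n} (1 + f(p) / p) < X`. -/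
def fullPsiSet (f : ℕ → ℝ) (a : ℕ) (r : ℤ) (X : ℝ) : Set ℕ :=
  {n : ℕ | 0 < n ∧ (n : ℤ) ≡ r [ZMOD (a : ℤ)] ∧ (n : ℝ) * psiRatio f n.primeFactors n < X}

theorem fullPsiSet_finite {f : ℕ → ℝ} (hf : ∀ p, |f p| ≤ 1) (a : ℕ) (r : ℤ) (X : ℝ) :
    (fullPsiSet f a r X).Finite :=
  (finite_setOf_lt_mul_totientRatio X).subset fun n hn =>
    ⟨hn.1, natCast_lt_mul_totientRatio (one_le_psiRatio_mul_totientRatio hf _ n) hn.2.2⟩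

/-- The integers up to a multiple of `X n / φ(n)` divisible by many primes outside `S`. -/
def primeTailSet (S : Finset ℕ) (η X : ℝ) : Set ℕ :=
  {n : ℕ | 0 < n ∧ (n : ℝ) < X * totientRatio n ∧ η ≤ primeTail S n}

theorem primeTailSet_finite (S : Finset ℕ) (η X : ℝ) : (primeTailSet S η X).Finite :=
  (finite_setOf_lt_mul_totientRatio X).subset fun _ hn => ⟨hn.1, hn.2.1⟩

/-- Off the exceptional set the primes outside `S` alter the product by a factor at least `exp(-η)`,
so enlarging the threshold by `exp η` absorbs them. `ncard_psiSet_le` is the reverse comparison. -/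
theorem ncard_fullPsiSet_le {f : ℕ → ℝ} (hf : ∀ p, |f p| ≤ 1) (S : Finset ℕ) (a : ℕ) (r : ℤ)
    (η X : ℝ) : (fullPsiSet f a r X).ncard ≤
      (psiSet f S a r (Real.exp η * X)).ncard + (primeTailSet S η X).ncard := by
  refine le_trans (Set.ncard_le_ncard ?_ ((psiSet_finite hf _ _ _ _).union
    (primeTailSet_finite S η X))) (Set.ncard_union_le _ _)
  rintro n ⟨h0, hr, hn⟩
  rcases le_or_gt η (primeTail S n) with h | h
  · exact Or.inr ⟨h0, natCast_lt_mul_totientRatio (one_le_psiRatio_mul_totientRatio hf _ n) hn, h⟩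
  · refine Or.inl ⟨h0, hr, ?_⟩
    calc (n : ℝ) * psiRatio f S n
        ≤ n * (psiRatio f n.primeFactors n * Real.exp (primeTail S n)) := by
          gcongr
          exact psiRatio_le hf S n
      _ ≤ n * (psiRatio f n.primeFactors n * Real.exp η) := by
          have := (psiRatio_pos hf n.primeFactors n).le
          gcongr
      _ = Real.exp η * (n * psiRatio f n.primeFactors n) := by ring
      _ < _ := by gcongr

theorem ncard_psiSet_le {f : ℕ → ℝ} (hf : ∀ p, |f p| ≤ 1) (S : Finset ℕ) (a : ℕ) (r : ℤ)
    {η X : ℝ} (hη : 0 < η) (hX : 0 < X) : (psiSet f S a r (Real.exp (-η) * X)).ncard ≤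
      (fullPsiSet f a r X).ncard + (primeTailSet S η X).ncard := by
  refine le_trans (Set.ncard_le_ncard ?_ ((fullPsiSet_finite hf _ _ _).union
    (primeTailSet_finite S η X))) (Set.ncard_union_le _ _)
  rintro n ⟨h0, hr, hn⟩
  rcases le_or_gt η (primeTail S n) with h | h
  · refine Or.inr ⟨h0, natCast_lt_mul_totientRatio (one_le_psiRatio_mul_totientRatio hf S n)
      (hn.trans_le ?_), h⟩
    exact mul_le_of_le_one_left hX.le (Real.exp_le_one_iff.2 (by linarith))
  · refine Or.inl ⟨h0, hr, ?_⟩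
    calc (n : ℝ) * psiRatio f n.primeFactors n
        ≤ n * (psiRatio f S n * Real.exp (primeTail S n)) := by
          gcongr
          exact psiRatio_primeFactors_le hf S n
      _ ≤ n * (psiRatio f S n * Real.exp η) := by
          have := (psiRatio_pos hf S n).le
          gcongr
      _ = Real.exp η * (n * psiRatio f S n) := by ring
      _ < Real.exp η * (Real.exp (-η) * X) := by gcongr
      _ = X := by rw [← mul_assoc, ← Real.exp_add]; simp

theorem eventually_sum_inv_sq_le {δ : ℝ} (hδ : 0 < δ) : ∀ᶠ S : Finset ℕ in atTop,
    ∀ u : Finset ℕ, Disjoint u S → ∑ p ∈ u, ((p : ℝ) ^ 2)⁻¹ ≤ δ := by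
  obtain ⟨s, hs⟩ := summable_iff_vanishing_norm.1 (Real.summable_nat_pow_inv.2 one_lt_two) δ hδ
  filter_upwards [eventually_ge_atTop s] with S hS u hu
  exact (le_abs_self _).trans (hs u (hu.mono_right hS)).le

theorem exists_small_of_tendsto {φ : ℝ → ℝ} (hφ : Continuous φ) {L c : ℝ} (h : φ 0 * L < c) :
    ∃ η : ℝ, 0 < η ∧ φ η * L < c := by
  have h1 : ∀ᶠ η in nhds (0 : ℝ), φ η * L < c :=
    (hφ.mul continuous_const).continuousAt.eventually_lt continuousAt_const h
  have h2 := (h1.filter_mono nhdsWithin_le_nhds).and (self_mem_nhdsWithin (s := Set.Ioi (0 : ℝ)))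
  obtain ⟨η, h3, h4⟩ := h2.exists
  exact ⟨η, h4, h3⟩

/-- The order of choices is `η`, then `S`, then `X`: the tail bound holds for every `X > 0`, so `S`
can be fixed before `X` grows. -/
theorem ncard_fullPsiSet_div_tendsto {f : ℕ → ℝ} (hf : ∀ p, |f p| ≤ 1) {C : ℝ}
    (hC : HasProd (localDensity f) C) {a : ℕ} (ha : 0 < a)
    (hfa : ∀ p : ℕ, p.Prime → p ∣ a → f p = 0) (r : ℤ) :
    Tendsto (fun X : ℝ => ((fullPsiSet f a r X).ncard : ℝ) / X) atTop (nhds (C / a)) := by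
  obtain ⟨M, hM, hB⟩ := exists_ncard_primeTail_le
  have hS : ∀ S : Finset ℕ, ∀ κ : ℝ, 0 < κ →
      Tendsto (fun X : ℝ => ((psiSet f S a r (κ * X)).ncard : ℝ) / X) atTop
        (nhds (κ * ((∏ p ∈ S, localDensity f p) / a))) := by
    intro S κ hκ
    have h := ((ncard_psiSet_div_tendsto hf S a r ha fun p _ => hfa p).comp
      (tendsto_id.const_mul_atTop hκ)).const_mul κ
    refine h.congr fun X => ?_
    simp only [Function.comp_apply, id_eq]
    field_simp
  have hprod : Tendsto (fun S : Finset ℕ => (∏ p ∈ S, localDensity f p) / (a : ℝ)) atTop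
      (nhds (C / a)) := Tendsto.div_const hC _
  have htail : ∀ η c : ℝ, 0 < η → 0 < c → ∀ᶠ S : Finset ℕ in atTop, ∀ X : ℝ, 0 < X →
      ((primeTailSet S η X).ncard : ℝ) / X ≤ c := by
    intro η c hη hc
    filter_upwards [eventually_sum_inv_sq_le (show 0 < c * η / M by positivity)] with S hS X hX
    rw [div_le_iff₀ hX]
    refine (hB S _ η X hX hη hS).trans_eq ?_
    field_simp
  refine tendsto_order.2 ⟨fun c hc => ?_, fun c hc => ?_⟩
  -- The signs are flipped to obtain the lower bound `c < exp(-η) C/a` from a lemma about upper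
  -- bounds.
  · obtain ⟨η, hη, hlt⟩ := exists_small_of_tendsto (φ := fun η => -Real.exp (-η)) (by fun_prop)
      (show -Real.exp (-0) * (C / a) < -c by simpa using hc)
    -- Half of the gap absorbs the exceptional set, the other half the error of the partial product
    -- and of the limit in `X`.
    have hgap : 0 < (Real.exp (-η) * (C / a) - c) / 2 := by linarith
    obtain ⟨S, h1, h2⟩ := ((htail η _ hη hgap).and ((hprod.const_mul (Real.exp (-η))).eventually_const_lt
      (show (Real.exp (-η) * (C / a) + c) / 2 < _ by linarith))).exists
    filter_upwards [(hS S _ (Real.exp_pos (-η))).eventually_const_lt h2, eventually_gt_atTop 0]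
      with X h3 hX
    have h4 : ((psiSet f S a r (Real.exp (-η) * X)).ncard : ℝ) / X ≤
        (fullPsiSet f a r X).ncard / X + (primeTailSet S η X).ncard / X := by
      rw [← add_div]
      gcongr
      exact_mod_cast ncard_psiSet_le hf S a r hη hX
    linarith [h1 X hX]
  · obtain ⟨η, hη, hlt⟩ := exists_small_of_tendsto Real.continuous_exp
      (show Real.exp 0 * (C / a) < c by simpa using hc)
    have hgap : 0 < (c - Real.exp η * (C / a)) / 2 := by linarith
    obtain ⟨S, h1, h2⟩ := ((htail η _ hη hgap).and ((hprod.const_mul (Real.exp η)).eventually_lt_const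
      (show _ < (Real.exp η * (C / a) + c) / 2 by linarith))).exists
    filter_upwards [(hS S _ (Real.exp_pos η)).eventually_lt_const h2, eventually_gt_atTop 0]
      with X h3 hX
    have h4 : ((fullPsiSet f a r X).ncard : ℝ) / X ≤
        (psiSet f S a r (Real.exp η * X)).ncard / X + (primeTailSet S η X).ncard / X := by
      rw [← add_div]
      gcongr
      exact_mod_cast ncard_fullPsiSet_le hf S a r η X
    linarith [h1 X hX]

/-! ### The quadratic character -/

theorem abs_quadCharNeg_le_one (d : ℕ) [NeZero d] (p : ℕ) :
    |((quadCharNeg d (p : ZMod d) : ℤ) : ℝ)| ≤ 1 := by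
  rw [quadCharNeg_natCast]
  rcases jacobiSym.trichotomy (p : ℤ) d with h | h | h <;> simp [h]

theorem quadCharNeg_eq_zero_of_dvd (d : ℕ) [NeZero d] {p : ℕ} (hp : p.Prime) (hpd : p ∣ d) :
    quadCharNeg d (p : ZMod d) = 0 := by
  rw [quadCharNeg_natCast, jacobiSym.eq_zero_iff_not_coprime, Int.gcd_natCast_natCast,
    Nat.gcd_eq_left hpd]
  exact hp.ne_one

/-- Each factor differs from `1` by `-χ(p) / (p (p + χ(p)))`, which is at most `2/p²` in absolute
value because `p + χ(p) ≥ p - 1 ≥ p/2`. -/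
theorem multipliable_densityFactor (d : ℕ) [NeZero d] : Multipliable (densityFactor d) := by
  have hsum : Summable fun p : Nat.Primes => 2 * (((p : ℕ) : ℝ) ^ 2)⁻¹ :=
    ((Real.summable_nat_pow_inv.2 one_lt_two).comp_injective
      Nat.Primes.coe_nat_injective).mul_left 2
  have h : Summable fun p : Nat.Primes => densityFactor d p - 1 := by
    refine hsum.of_norm_bounded fun p => ?_
    have hp0 : (2 : ℝ) ≤ (p : ℕ) := by exact_mod_cast p.2.two_le
    have hf := abs_quadCharNeg_le_one d p
    rw [densityFactor]
    set x := ((quadCharNeg d ((p : ℕ) : ZMod d) : ℤ) : ℝ)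
    have hx := abs_le.1 hf
    have hpos : (0 : ℝ) < (p : ℕ) + x := by linarith
    have e : 1 - ((p : ℕ) : ℝ)⁻¹ + (((p : ℕ) : ℝ) + x)⁻¹ - 1 = -x / ((p : ℕ) * ((p : ℕ) + x)) := by
      field_simp
      ring
    have hden : 0 < ((p : ℕ) : ℝ) * ((p : ℕ) + x) := mul_pos (by linarith) hpos
    rw [e, Real.norm_eq_abs, abs_div, abs_neg, abs_of_pos hden, div_le_iff₀ hden]
    refine hf.trans ?_
    field_simp
    linarith
  simpa using Real.multipliable_one_add_of_summable h

/-- Extending the factors by `1` off the primes turns the Euler product into a limit over finite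
subsets of `ℕ`, the form in which the truncation sets `S` occur. -/
theorem hasProd_localDensity (d : ℕ) [NeZero d] :
    HasProd (localDensity fun p => ((quadCharNeg d (p : ZMod d) : ℤ) : ℝ)) (densityConst d) := by
  have h := (multipliable_densityFactor d).hasProd
  have e : densityFactor d =
      (fun p : ℕ => 1 - (p : ℝ)⁻¹ + ((p : ℝ) + ((quadCharNeg d (p : ZMod d) : ℤ) : ℝ))⁻¹) ∘
        ((↑) : {p : ℕ | p.Prime} → ℕ) := rfl
  change HasProd (densityFactor d) (densityConst d) at h
  rw [e] at h
  refine (hasProd_subtype_iff_mulIndicator.1 h).congr_fun fun p => ?_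
  by_cases hp : p.Prime <;> simp [localDensity, hp]

theorem countedSet_eq_fullPsiSet (d : ℕ) [NeZero d] (a : ℕ) (r : ℤ) (X : ℝ) :
    countedSet d a r X =
      fullPsiSet (fun p => ((quadCharNeg d (p : ZMod d) : ℤ) : ℝ)) a r X := by
  simp only [countedSet, fullPsiSet, twistedPsi, psiRatio, Finset.inter_self]

theorem mainTheorem5 (d : ℕ) [NeZero d] (hd_sqf : Squarefree d) (hd_mod : d % 4 = 3)
    (a : ℕ) (ha_pos : 0 < a) (ha : ∀ p : ℕ, p.Prime → p ∣ a → p ∣ d) (r : ℤ) :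
    Multipliable (densityFactor d) ∧
    (∀ X : ℝ, (countedSet d a r X).Finite) ∧
    (fun X : ℝ => ((countedSet d a r X).ncard : ℝ) - densityConst d / (a : ℝ) * X)
      =o[atTop] (fun X : ℝ => X) := by
  have hf := abs_quadCharNeg_le_one d
  refine ⟨multipliable_densityFactor d, fun X => ?_, ?_⟩
  · rw [countedSet_eq_fullPsiSet]
    exact fullPsiSet_finite hf a r X
  · have h := ncard_fullPsiSet_div_tendsto hf (hasProd_localDensity d) ha_pos
      (fun p hp hpa => by rw [quadCharNeg_eq_zero_of_dvd d hp (ha p hp hpa), Int.cast_zero]) r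
    have h0 := h.sub_const (densityConst d / a)
    rw [sub_self] at h0
    refine (isLittleO_iff_tendsto' ?_).2 (h0.congr' ?_)
    · filter_upwards [eventually_gt_atTop 0] with X hX h
      exact absurd h hX.ne'
    · filter_upwards [eventually_gt_atTop 0] with X hX
      rw [countedSet_eq_fullPsiSet, sub_div, mul_div_cancel_right₀ _ hX.ne']
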